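/- Let $n\ge 0$. A two-line array is a finite sequence of columns $\binom{j}{i}$ of positive integers (top entry $j$, bottom entry $i$); it is lexicographically ordered if the top entries increase weakly and, among columns with equal top entry, the bottom entries increase weakly. **Classical bijection.** To a symmetric $n\times n$ matrix $A=(a_{i,j})$ with non-negative integer entries associate the lexicographically ordered two-line array $w(A)$ with $a_{i,j}$ columns $\binom{i}{j}$ for all $1\le i,j\le n$. The classical Robinson–Schensted–Knuth (RSK) algorithm row-inserts the bottom entries from left to right and records the top entries at the newly created cells; it yields a pair (insertion tableau, recording tableau). For symmetric $A$ both tableaux are equal to one tableau $P(A)$, and the classical bijection is $A\mapsto P(A)$. **Simplified algorithm.** To a symmetric $n\times n$ matrix $A$ with non-negative integer entries associate the lexicographically ordered two-line array $w'(A)$ with $a_{i,j}$ columns $\binom{j}{i}$ for all $1\le i\le j\le n$. Starting from the empty tableau, work through the columns of a two-line array from left to right. For a column $\binom{j}{i}$, $i\le j$, insert $i$ into the current tableau by the usual RSK row insertion. If $i<j$ and this insertion ends with adding an entry to row $r$, then additionally place $j$ in row $r+1$, in the leftmost column where that row has no entry so far. **Proposition.** (1) The map $A\mapsto w'(A)$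 is a bijection from the symmetric $n\times n$ matrices with non-negative integer entries onto the lexicographically ordered two-line arrays with entries in $\{1,\dots,n\}$ in which no top entry is smaller than the bottom entry of its column. (2) The simplified algorithm transforms every such two-line array into a semistandard Young tableau with entries in $\{1,\dots,n\}$. (3) The map sending $A$ to the result of the simplified algorithm applied to $w'(A)$ is a bijection from the set of symmetric $n\times n$ matrices with non-negative integer entries onto the set of semistandard Young tableaux (of any shape) with entries in $\{1,\dots,n\}$, and it is the same bijection as the classical one: for every symmetric $A$, the RSK algorithm applied to $w(A)$ yields the pair $(T,T)$, where $T$ is the result of the simplified algorithm applied to $w'(A)$. -/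

import Mathlib

namespace SimplifiedRSK

/-- Row insertion of `x` into a single row: the leftmost entry that is larger than `x` is replaced
by `x` and bumped out (returned as `some y`); if there is none, `x` is appended (and `none` is
returned). -/
def rowInsert (x : ℕ) : List ℕ → List ℕ × Option ℕ
  | [] => ([x], none)
  | y :: ys =>
    if x < y then (x :: ys, some y)
    else (y :: (rowInsert x ys).1, (rowInsert x ys).2)

/-- The usual RSK insertion of `x` into a tableau, given as the list of its rows from top to bottom.
The result is the new tableau together with the (zero-based) index of the row at the end of which
the insertion has added a new cell. -/
def insert (x : ℕ) : List (List ℕ) → List (List ℕ) × ℕ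
  | [] => ([[x]], 0)
  | r :: rs =>
    match rowInsert x r with
    | (r', none) => (r' :: rs, 0)
    | (r', some y) => (r' :: (insert y rs).1, (insert y rs).2 + 1)

/-- Place `j` into the row with (zero-based) index `k`, in the leftmost column where that row has no
entry so far. If the row is still empty, then a new row is started at the bottom. (This is
only used when `k` is at most the number of rows.) -/
def placeInRow (j : ℕ) : ℕ → List (List ℕ) → List (List ℕ)
  | _, [] => [[j]]
  | 0, r :: rs => (r ++ [j]) :: rs
  | k + 1, r :: rs => r :: placeInRow j k rs

/-- One step of the classical RSK algorithm on a pair (insertion tableau, recording tableau): for the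
column `c` with top entry `c.1` and bottom entry `c.2`, insert the bottom entry into the
insertion tableau, and record the top entry in the recording tableau at the new cell. -/
def rskStep (PQ : List (List ℕ) × List (List ℕ)) (c : ℕ × ℕ) :
    List (List ℕ) × List (List ℕ) :=
  ((insert c.2 PQ.1).1, placeInRow c.1 (insert c.2 PQ.1).2 PQ.2)

/-- The classical RSK algorithm: the pair (insertion tableau, recording tableau) of a two-line array,
which is given as the list of its columns (top entry, bottom entry). -/
def rsk (w : List (ℕ × ℕ)) : List (List ℕ) × List (List ℕ) :=
  w.foldl rskStep ([], [])

/-- One step of the simplified algorithm, for the column `c` with top entry `c.1` and bottom entry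
`c.2`: insert the bottom entry; if it is smaller than the top entry, then additionally place the
top entry in the row right below the row in which the insertion has ended. -/
def simplifiedStep (T : List (List ℕ)) (c : ℕ × ℕ) : List (List ℕ) :=
  if c.2 < c.1 then placeInRow c.1 ((insert c.2 T).2 + 1) (insert c.2 T).1
  else (insert c.2 T).1

/-- The simplified algorithm, working through the columns (top entry, bottom entry) of a two-line
array from left to right. -/
def simplifiedRSK (w : List (ℕ × ℕ)) : List (List ℕ) :=
  w.foldl simplifiedStep []

/-- The two-line array of a matrix in the classical algorithm: `A i j` columns with top entry `i` and
bottom entry `j`, in lexicographic order. Rows and columns of the matrix are indexed by `Fin n`, so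
that the index `i : Fin n` stands for the number `i + 1`. -/
def classicalArray {n : ℕ} (A : Matrix (Fin n) (Fin n) ℕ) : List (ℕ × ℕ) :=
  (List.finRange n).flatMap fun i =>
    (List.finRange n).flatMap fun j => List.replicate (A i j) ((i : ℕ) + 1, (j : ℕ) + 1)

/-- The two-line array of a (symmetric) matrix in the simplified algorithm: for `i ≤ j` there are
`A i j` columns with top entry `j` and bottom entry `i`, in lexicographic order. -/
def simplifiedArray {n : ℕ} (A : Matrix (Fin n) (Fin n) ℕ) : List (ℕ × ℕ) :=
  (List.finRange n).flatMap fun j =>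
    ((List.finRange n).filter fun i => i ≤ j).flatMap fun i =>
      List.replicate (A i j) ((j : ℕ) + 1, (i : ℕ) + 1)

/-- Lexicographically ordered two-line arrays with entries in `{1, …, n}` such that no top entry is
smaller than the bottom entry of its column. -/
def IsSimplifiedArray (n : ℕ) (w : List (ℕ × ℕ)) : Prop :=
  w.Pairwise (fun c d => c.1 < d.1 ∨ (c.1 = d.1 ∧ c.2 ≤ d.2)) ∧
    ∀ c ∈ w, 1 ≤ c.2 ∧ c.2 ≤ c.1 ∧ c.1 ≤ n

/-- Semistandard Young tableaux, of any shape, with entries in `{1, …, n}`. -/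
abbrev BoundedSSYT (n : ℕ) : Type :=
  {T : Σ μ : YoungDiagram, SemistandardYoungTableau μ //
    ∀ i j : ℕ, (i, j) ∈ T.1 → 1 ≤ T.2 i j ∧ T.2 i j ≤ n}

/-- The list of the rows of a semistandard Young tableau, from top to bottom, each row being the list
of its entries from left to right. -/
def BoundedSSYT.rows {n : ℕ} (T : BoundedSSYT n) : List (List ℕ) :=
  (List.range (T.1.1.colLen 0)).map fun i =>
    (List.range (T.1.1.rowLen i)).map fun j => T.1.2 i j

end SimplifiedRSK

namespace SimplifiedRSK

/-! Encode a tableau by its chain of shapes: `cnt m (row T k)` is the length of row `k` of the part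
of `T` with entries at most `m`. Inserting a weakly increasing word changes this chain by the local
rule `grow`, which computes each new shape from three neighbouring ones (`cnt_insertWord`).
Classical RSK therefore computes the growth diagram `growth a` of the matrix: the insertion tableau
records its last row of shapes and the recording tableau its last column (`rsk_rowsArray`). For
symmetric `a` the diagram is symmetric, so the two tableaux agree.

The simplified algorithm passes from one diagonal position `(j, j)` to the next. Processing all
columns with top entry `j + 1` inserts the smaller letters exactly as RSK would, and adds to row `k
+ 1` as many copies of `j + 1` as row `k` has gained cells, and `a j j` copies to row `0`
(`row_foldl_tokenStep`). This is the local rule at a diagonal square, where symmetry makes both side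
shapes equal so that `max` and `min` collapse. Hence both algorithms give the same tableau
(`simplifiedRSK_triangularArray`).

Bijectivity comes from running the diagram backwards from its outer shapes: on interlacing shapes
`shrink` inverts `grow`, and the matrix entry is recovered from the first row (`growth_injective`,
`growth_surjective`). Interlacing of the chain is column strictness, which links lists of rows to
semistandard tableaux (`exists_rows_eq`, `BoundedSSYT.interlace_rows`). -/

/-! ### Inserting a word into a single row -/

/-- The number of entries of a row that are at most `m`. -/
def cnt (m : ℕ) (r : List ℕ) : ℕ := r.countP (· ≤ m)

lemma cnt_nil (m : ℕ) : cnt m [] = 0 := rfl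

lemma cnt_cons (m x : ℕ) (r : List ℕ) : cnt m (x :: r) = cnt m r + if x ≤ m then 1 else 0 := by
  simp [cnt, List.countP_cons]

lemma cnt_append (m : ℕ) (r s : List ℕ) : cnt m (r ++ s) = cnt m r + cnt m s := by
  simp [cnt]

lemma cnt_replicate (m q x : ℕ) : cnt m (List.replicate q x) = if x ≤ m then q else 0 := by
  simp [cnt, List.countP_replicate]

lemma cnt_succ (m : ℕ) (r : List ℕ) : cnt (m + 1) r = cnt m r + r.count (m + 1) := by
  induction r with
  | nil => rfl
  | cons x r ih =>
    rw [cnt_cons, cnt_cons, ih, List.count_cons]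
    by_cases h : x = m + 1
    · subst h; simp; omega
    · by_cases h' : x ≤ m
      · simp [h, h', Nat.le_succ_of_le h']; omega
      · have : ¬ x ≤ m + 1 := by omega
        simp [h, h', this]

lemma cnt_mono {m m' : ℕ} (h : m ≤ m') (r : List ℕ) : cnt m r ≤ cnt m' r :=
  List.countP_mono_left fun x _ hx => by simp at hx ⊢; omega

lemma cnt_eq_length {m : ℕ} {r : List ℕ} (h : ∀ x ∈ r, x ≤ m) : cnt m r = r.length := by
  simpa [cnt, List.countP_eq_length] using h

lemma cnt_eq_zero {m : ℕ} {r : List ℕ} (h : ∀ x ∈ r, m < x) : cnt m r = 0 := by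
  simpa [cnt, List.countP_eq_zero] using h

lemma rowInsert_perm (x : ℕ) (r : List ℕ) :
    ((rowInsert x r).1 ++ (rowInsert x r).2.toList).Perm (x :: r) := by
  induction r with
  | nil => simp [rowInsert]
  | cons y ys ih =>
    rw [rowInsert]
    split_ifs
    · simp
    · exact (ih.cons y).trans (List.Perm.swap _ _ _)

lemma mem_of_mem_rowInsert {x y : ℕ} {r : List ℕ} (h : y ∈ (rowInsert x r).1) :
    y = x ∨ y ∈ r := by
  have := (rowInsert_perm x r).mem_iff.1 (List.mem_append_left _ h)
  simpa using this

lemma mem_of_mem_rowInsert_bumped {x y : ℕ} {r : List ℕ} (h : y ∈ (rowInsert x r).2) :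
    y ∈ r := by
  induction r with
  | nil => simp [rowInsert] at h
  | cons z zs ih =>
    rw [rowInsert] at h
    split_ifs at h
    · simp at h; simp [h]
    · exact List.mem_cons_of_mem _ (ih h)

lemma rowInsert_sorted (x : ℕ) {r : List ℕ} (hr : r.Pairwise (· ≤ ·)) :
    (rowInsert x r).1.Pairwise (· ≤ ·) := by
  induction r with
  | nil => simp [rowInsert]
  | cons y ys ih =>
    rw [List.pairwise_cons] at hr
    rw [rowInsert]
    split_ifs with h
    · exact List.pairwise_cons.2 ⟨fun z hz => h.le.trans (hr.1 z hz), hr.2⟩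
    · refine List.pairwise_cons.2 ⟨fun z hz => ?_, ih hr.2⟩
      rcases mem_of_mem_rowInsert hz with rfl | hz
      · omega
      · exact hr.1 z hz

/-- The letter `x` lands at position `cnt x r`. For `x ≤ m` the count grows only if no entry above
`x` and at most `m` was there to be bumped, that is, if `cnt m r = cnt x r`. -/
lemma cnt_rowInsert (x m : ℕ) {r : List ℕ} (hr : r.Pairwise (· ≤ ·)) :
    cnt m (rowInsert x r).1 = if m < x then cnt m r else max (cnt m r) (cnt x r + 1) := by
  induction r with
  | nil => simp only [rowInsert, cnt_cons, cnt_nil]; split_ifs <;> omega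
  | cons y ys ih =>
    rw [List.pairwise_cons] at hr
    rw [rowInsert]
    split_ifs with h h'
    · have := cnt_eq_zero fun z hz => lt_of_lt_of_le (h'.trans h) (hr.1 z hz)
      simp only [cnt_cons, this]; split_ifs <;> omega
    · have := cnt_eq_zero fun z hz => lt_of_lt_of_le h (hr.1 z hz)
      have hy : ¬ y ≤ m → cnt m ys = 0 := fun hm =>
        cnt_eq_zero fun z hz => lt_of_lt_of_le (not_le.1 hm) (hr.1 z hz)
      simp only [cnt_cons, this]; split_ifs <;> omega
    · simp only [cnt_cons, ih hr.2]; split_ifs <;> rfl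
    · simp only [cnt_cons, ih hr.2]; split_ifs <;> omega

/-- Successive insertion of the letters of `u` into the row `r`: the resulting row, and for each
letter the entry that it bumps out, if any. -/
def rowOut : List ℕ → List ℕ → List ℕ × List (Option ℕ)
  | [], r => (r, [])
  | x :: u, r =>
    ((rowOut u (rowInsert x r).1).1, (rowInsert x r).2 :: (rowOut u (rowInsert x r).1).2)

/-- The word of the entries bumped out by successive insertion of `u` into the row `r`. -/
def bumped (u r : List ℕ) : List ℕ := (rowOut u r).2.reduceOption

lemma bumped_cons (x : ℕ) (u r : List ℕ) :
    bumped (x :: u) r = (rowInsert x r).2.toList ++ bumped u (rowInsert x r).1 := by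
  simp only [bumped, rowOut]
  cases (rowInsert x r).2 <;> simp

lemma rowOut_append_singleton (u : List ℕ) (x : ℕ) (r : List ℕ) :
    (rowOut (u ++ [x]) r).1 = (rowInsert x (rowOut u r).1).1 := by
  induction u generalizing r with
  | nil => rfl
  | cons y u ih => exact ih _

lemma rowOut_perm (u r : List ℕ) : ((rowOut u r).1 ++ bumped u r).Perm (u ++ r) := by
  induction u generalizing r with
  | nil => simp [rowOut, bumped]
  | cons x u ih =>
    rw [bumped_cons, rowOut]
    have h1 := (ih (rowInsert x r).1).append_left (rowInsert x r).2.toList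
    have h2 := (rowInsert_perm x r).append_left u
    rw [List.perm_iff_count] at *
    intro y
    have := h1 y
    have := h2 y
    simp only [List.count_append, List.cons_append, List.count_cons] at *
    omega

lemma rowOut_sorted (u : List ℕ) {r : List ℕ} (hr : r.Pairwise (· ≤ ·)) :
    (rowOut u r).1.Pairwise (· ≤ ·) := by
  induction u generalizing r with
  | nil => exact hr
  | cons x u ih => exact ih (rowInsert_sorted x hr)

lemma mem_of_mem_bumped {u r : List ℕ} {y : ℕ} (h : y ∈ bumped u r) : y ∈ u ∨ y ∈ r := by
  simpa using (rowOut_perm u r).mem_iff.1 (List.mem_append_right _ h)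

lemma length_rowOut_snd (u r : List ℕ) : (rowOut u r).2.length = u.length := by
  induction u generalizing r with
  | nil => rfl
  | cons x u ih => simp [rowOut, ih]

/-- Letters at most `m` come first and eat into the old entries `m + 1`, which gives the maximum;
each later letter `m + 1` then extends the initial segment by one cell, and larger letters do not
affect it. -/
lemma cnt_rowOut {u r : List ℕ} (hu : u.Pairwise (· ≤ ·)) (hr : r.Pairwise (· ≤ ·)) (m : ℕ) :
    cnt (m + 1) (rowOut u r).1 =
      max (cnt m (rowOut u r).1) (cnt (m + 1) r) + u.count (m + 1) := by
  induction u using List.reverseRecOn with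
  | nil => simpa [rowOut] using cnt_mono (Nat.le_succ m) r
  | append_singleton u x ih =>
    rw [List.pairwise_append] at hu
    obtain ⟨hu, -, hux⟩ := hu
    have ih := ih hu
    have hs := rowOut_sorted u hr
    rw [rowOut_append_singleton, cnt_rowInsert _ _ hs, cnt_rowInsert _ _ hs, List.count_append]
    rcases lt_trichotomy (m + 1) x with h | rfl | h
    · have h0 : List.count (m + 1) [x] = 0 := List.count_eq_zero.2 (by simp; omega)
      rw [if_pos h, if_pos (by omega), ih, h0]; omega
    · simp; omega
    · have h0 : List.count (m + 1) [x] = 0 := List.count_eq_zero.2 (by simp; omega)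
      have h1 : List.count (m + 1) u = 0 := List.count_eq_zero.2 fun hm => by
        have := hux _ hm x (by simp)
        omega
      rw [if_neg (by omega), if_neg (by omega), h0, h1]
      omega

/-- The old entries `m + 1` fill the positions from `cnt m r` up to `cnt (m + 1) r`, and those
overrun by the new entries at most `m` are bumped. Formally this is conservation of letters combined
with `cnt_rowOut`. -/
lemma count_bumped {u r : List ℕ} (hu : u.Pairwise (· ≤ ·)) (hr : r.Pairwise (· ≤ ·)) (m : ℕ) :
    (bumped u r).count (m + 1) = min (cnt m (rowOut u r).1) (cnt (m + 1) r) - cnt m r := by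
  have h1 := (List.perm_iff_count.1 (rowOut_perm u r)) (m + 1)
  have h2 := cnt_rowOut hu hr m
  have h3 := cnt_succ m r
  have h4 := cnt_succ m (rowOut u r).1
  simp only [List.count_append] at h1
  omega

/-- The entries bumped out by two successive insertions of weakly increasing letters increase
weakly, where an insertion without bumping counts as infinite. -/
def BumpLE (o o' : Option ℕ) : Prop := ∀ y' ∈ o', ∃ y ∈ o, y ≤ y'

lemma BumpLE.trans {a b c : Option ℕ} (h : BumpLE a b) (h' : BumpLE b c) : BumpLE a c := by
  intro z hz
  obtain ⟨y, hy, hyz⟩ := h' z hz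
  obtain ⟨x, hx, hxy⟩ := h y hy
  exact ⟨x, hx, hxy.trans hyz⟩

lemma bumpLE_rowInsert {x x' : ℕ} (h : x ≤ x') {r : List ℕ} (hr : r.Pairwise (· ≤ ·)) :
    BumpLE (rowInsert x r).2 (rowInsert x' (rowInsert x r).1).2 := by
  induction r with
  | nil => intro y hy; simp [rowInsert, Nat.not_lt.2 h] at hy
  | cons z zs ih =>
    rw [List.pairwise_cons] at hr
    by_cases hx : x < z
    · intro y hy
      simp only [rowInsert, hx, if_true, Nat.not_lt.2 h, if_false] at hy
      exact ⟨z, by simp [rowInsert, hx], hr.1 _ (mem_of_mem_rowInsert_bumped hy)⟩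
    · have hx' : ¬ x' < z := by omega
      simpa [rowInsert, hx, hx'] using ih hr.2

lemma rowOut_pairwise {u r : List ℕ} (hu : u.Pairwise (· ≤ ·)) (hr : r.Pairwise (· ≤ ·)) :
    (rowOut u r).2.Pairwise BumpLE := by
  have : IsTrans (Option ℕ) BumpLE := ⟨fun _ _ _ => BumpLE.trans⟩
  rw [← List.isChain_iff_pairwise]
  induction u generalizing r with
  | nil => simp [rowOut]
  | cons x u ih =>
    rw [List.pairwise_cons] at hu
    have := ih hu.2 (rowInsert_sorted x hr)
    rw [rowOut]
    cases u with
    | nil => simp [rowOut]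
    | cons x' u =>
      exact List.IsChain.cons_cons (bumpLE_rowInsert (hu.1 x' (by simp)) hr) this

/-- After a `none`, `BumpLE` admits only `none`: once a letter has been appended, no later one
bumps. -/
lemma eq_append_of_pairwise_bumpLE {l : List (Option ℕ)} (h : l.Pairwise BumpLE) :
    l = l.reduceOption.map some ++ List.replicate (l.length - l.reduceOption.length) none ∧
      l.reduceOption.Pairwise (· ≤ ·) := by
  induction l with
  | nil => simp
  | cons o l ih =>
    rw [List.pairwise_cons] at h
    obtain ⟨h1, h2⟩ := ih h.2
    cases o with
    | none =>
      have h0 : l.reduceOption = [] := by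
        rw [List.eq_nil_iff_forall_not_mem]
        intro y hy
        rw [List.reduceOption_mem_iff] at hy
        obtain ⟨z, hz, -⟩ := h.1 _ hy y rfl
        simp at hz
      rw [h0] at h1
      simp only [List.reduceOption_cons_of_none, h0, List.length_cons]
      refine ⟨?_, by simp⟩
      simp only [List.map_nil, List.nil_append, List.length_nil, Nat.sub_zero,
        List.replicate_succ] at h1 ⊢
      rw [← h1]
    | some y =>
      refine ⟨?_, ?_⟩
      · simpa using h1
      · rw [List.reduceOption_cons_of_some, List.pairwise_cons]
        refine ⟨fun z hz => ?_, h2⟩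
        rw [List.reduceOption_mem_iff] at hz
        obtain ⟨w, hw, hwz⟩ := h.1 _ hz z rfl
        simp at hw
        omega

lemma bumped_sorted {u r : List ℕ} (hu : u.Pairwise (· ≤ ·)) (hr : r.Pairwise (· ≤ ·)) :
    (bumped u r).Pairwise (· ≤ ·) :=
  (eq_append_of_pairwise_bumpLE (rowOut_pairwise hu hr)).2

lemma rowOut_snd_eq {u r : List ℕ} (hu : u.Pairwise (· ≤ ·)) (hr : r.Pairwise (· ≤ ·)) :
    (rowOut u r).2 = (bumped u r).map some ++
      List.replicate ((rowOut u r).1.length - r.length) none := by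
  have h := (eq_append_of_pairwise_bumpLE (rowOut_pairwise hu hr)).1
  have h' := (rowOut_perm u r).length_eq
  rw [length_rowOut_snd] at h
  simp only [List.length_append] at h'
  rw [show (rowOut u r).1.length - r.length = u.length - (bumped u r).length by omega]
  exact h

/-! ### Inserting a word into a tableau -/

/-- The row of index `k` of a tableau, which is empty below the last row. -/
def row (T : List (List ℕ)) (k : ℕ) : List ℕ := T.getD k []

@[simp] lemma row_nil (k : ℕ) : row [] k = [] := by simp [row]

@[simp] lemma row_cons_zero (r : List ℕ) (T : List (List ℕ)) : row (r :: T) 0 = r := rfl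

@[simp] lemma row_cons_succ (r : List ℕ) (T : List (List ℕ)) (k : ℕ) :
    row (r :: T) (k + 1) = row T k := rfl

lemma row_mem {T : List (List ℕ)} {k : ℕ} (h : k < T.length) : row T k ∈ T := by
  simp [row, List.getD_eq_getElem?_getD, h]

lemma row_eq_nil {T : List (List ℕ)} {k : ℕ} (h : T.length ≤ k) : row T k = [] := by
  simp [row, List.getD_eq_getElem?_getD, h]

lemma forall_mem_row {p : List ℕ → Prop} {T : List (List ℕ)} (h : ∀ r ∈ T, p r) (h0 : p [])
    (k : ℕ) : p (row T k) := by
  rcases lt_or_ge k T.length with hk | hk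
  · exact h _ (row_mem hk)
  · rwa [row_eq_nil hk]

/-- Successive insertion of the letters of `u` into the tableau `T`. -/
def insertWord (u : List ℕ) (T : List (List ℕ)) : List (List ℕ) :=
  u.foldl (fun T x => (insert x T).1) T

lemma insert_cons_fst (x : ℕ) (r : List ℕ) (rs : List (List ℕ)) :
    (insert x (r :: rs)).1 =
      (rowInsert x r).1 :: insertWord (rowInsert x r).2.toList rs := by
  rw [insert]
  rcases h : rowInsert x r with ⟨r', _ | y⟩ <;> simp [insertWord]

lemma insertWord_append (u v : List ℕ) (T : List (List ℕ)) :
    insertWord (u ++ v) T = insertWord v (insertWord u T) := List.foldl_append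

lemma insertWord_cons (u r : List ℕ) (rs : List (List ℕ)) :
    insertWord u (r :: rs) = (rowOut u r).1 :: insertWord (bumped u r) rs := by
  induction u generalizing r rs with
  | nil => rfl
  | cons x u ih =>
    rw [bumped_cons, insertWord_append, rowOut, ← ih, ← insert_cons_fst]
    rfl

/-- Lets the empty tableau be treated as a single empty row. Only rows are compared, since for empty
`u` the two lists differ. -/
lemma row_insertWord_nil (u : List ℕ) (k : ℕ) :
    row (insertWord u []) k = row (insertWord u [[]]) k := by
  cases u with
  | nil => cases k <;> simp [insertWord]
  | cons x u => rfl

/-- The local rule for the shapes in a growth diagram. -/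
def grow (a : ℕ) (μ l l' : ℕ → ℕ) : ℕ → ℕ
  | 0 => max (l 0) (l' 0) + a
  | k + 1 => max (l (k + 1)) (l' (k + 1)) + (min (l k) (l' k) - μ k)

lemma grow_comm (a : ℕ) (μ l l' : ℕ → ℕ) : grow a μ l l' = grow a μ l' l := by
  funext k
  cases k <;> simp [grow, max_comm, min_comm]

lemma cnt_insertWord {u : List ℕ} {T : List (List ℕ)} (hu : u.Pairwise (· ≤ ·))
    (hT : ∀ r ∈ T, r.Pairwise (· ≤ ·)) (m k : ℕ) :
    cnt (m + 1) (row (insertWord u T) k) =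
      grow (u.count (m + 1)) (fun k => cnt m (row T k))
        (fun k => cnt m (row (insertWord u T) k)) (fun k => cnt (m + 1) (row T k)) k := by
  induction k generalizing u T with
  | zero =>
    cases T with
    | nil =>
      simpa [grow, row_insertWord_nil, insertWord_cons] using cnt_rowOut hu List.Pairwise.nil m
    | cons r rs =>
      simpa [grow, insertWord_cons] using cnt_rowOut hu (hT r (by simp)) m
  | succ k ih =>
    have key : ∀ r rs, (∀ s ∈ r :: rs, s.Pairwise (· ≤ ·)) →
        cnt (m + 1) (row (insertWord u (r :: rs)) (k + 1)) =
          grow (u.count (m + 1)) (fun k => cnt m (row (r :: rs) k))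
            (fun k => cnt m (row (insertWord u (r :: rs)) k))
            (fun k => cnt (m + 1) (row (r :: rs) k)) (k + 1) := by
      intro r rs h
      have hr := h r (by simp)
      have := ih (bumped_sorted hu hr) fun s hs => h s (List.mem_cons_of_mem _ hs)
      -- The bumped word plays the role of `u` for the remaining rows; its number of letters `m + 1`
      -- is the summand `min - μ` of the local rule, which matters only in the row right below the
      -- first.
      cases k with
      | zero => simpa [grow, insertWord_cons, count_bumped hu hr] using this
      | succ k => simpa [grow, insertWord_cons] using this
    cases T with
    | nil =>
      have := key [] [] (by simp)
      simp only [← row_insertWord_nil] at this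
      rw [this]
      cases k <;> simp [grow]
    | cons r rs => exact key r rs hT

/-- Tableaux with nonempty weakly increasing rows and entries in `{1, …, n}`. -/
structure IsRowTableau (n : ℕ) (T : List (List ℕ)) : Prop where
  ne_nil : ∀ r ∈ T, r ≠ []
  sorted : ∀ r ∈ T, r.Pairwise (· ≤ ·)
  pos : ∀ r ∈ T, ∀ x ∈ r, 1 ≤ x
  le : ∀ r ∈ T, ∀ x ∈ r, x ≤ n

namespace IsRowTableau

lemma nil (n : ℕ) : IsRowTableau n [] := ⟨by simp, by simp, by simp, by simp⟩

lemma mono {n n' : ℕ} (h : n ≤ n') {T : List (List ℕ)} (hT : IsRowTableau n T) :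
    IsRowTableau n' T :=
  ⟨hT.1, hT.2, hT.3, fun r hr x hx => (hT.4 r hr x hx).trans h⟩

lemma row_sorted {n : ℕ} {T : List (List ℕ)} (hT : IsRowTableau n T) (k : ℕ) :
    (row T k).Pairwise (· ≤ ·) := forall_mem_row hT.sorted .nil k

lemma row_pos {n : ℕ} {T : List (List ℕ)} (hT : IsRowTableau n T) (k : ℕ) :
    ∀ x ∈ row T k, 1 ≤ x := forall_mem_row hT.pos (by simp) k

lemma row_le {n : ℕ} {T : List (List ℕ)} (hT : IsRowTableau n T) (k : ℕ) :
    ∀ x ∈ row T k, x ≤ n := forall_mem_row hT.le (by simp) k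

lemma cnt_zero {n : ℕ} {T : List (List ℕ)} (hT : IsRowTableau n T) (k : ℕ) :
    cnt 0 (row T k) = 0 := cnt_eq_zero (hT.row_pos k)

lemma cnt_eq_length {n : ℕ} {T : List (List ℕ)} (hT : IsRowTableau n T) (k : ℕ) :
    cnt n (row T k) = (row T k).length := SimplifiedRSK.cnt_eq_length (hT.row_le k)

lemma row_ne_nil {n : ℕ} {T : List (List ℕ)} (hT : IsRowTableau n T) {k : ℕ} :
    row T k ≠ [] ↔ k < T.length := by
  refine ⟨fun h => ?_, fun h => hT.ne_nil _ (row_mem h)⟩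
  by_contra hk
  exact h (row_eq_nil (not_lt.1 hk))

lemma cons_iff {n : ℕ} {r : List ℕ} {T : List (List ℕ)} :
    IsRowTableau n (r :: T) ↔
      (r ≠ [] ∧ r.Pairwise (· ≤ ·) ∧ (∀ x ∈ r, 1 ≤ x) ∧ ∀ x ∈ r, x ≤ n) ∧ IsRowTableau n T := by
  constructor
  · rintro ⟨h1, h2, h3, h4⟩
    rw [List.forall_mem_cons] at h1 h2 h3 h4
    exact ⟨⟨h1.1, h2.1, h3.1, h4.1⟩, h1.2, h2.2, h3.2, h4.2⟩
  · rintro ⟨⟨h1, h2, h3, h4⟩, h⟩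
    refine ⟨?_, ?_, ?_, ?_⟩ <;> rw [List.forall_mem_cons]
    exacts [⟨h1, h.1⟩, ⟨h2, h.2⟩, ⟨h3, h.3⟩, ⟨h4, h.4⟩]

lemma singleton {n x : ℕ} (hx : 1 ≤ x) (hxn : x ≤ n) : IsRowTableau n [[x]] :=
  cons_iff.2 ⟨by simp [hx, hxn], nil n⟩

lemma insert {n x : ℕ} {T : List (List ℕ)} (hT : IsRowTableau n T) (hx : 1 ≤ x)
    (hxn : x ≤ n) : IsRowTableau n (insert x T).1 := by
  induction T generalizing x with
  | nil => exact singleton hx hxn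
  | cons r rs ih =>
    obtain ⟨⟨h1, h2, h3, h4⟩, hrs⟩ := cons_iff.1 hT
    rw [insert_cons_fst, cons_iff]
    refine ⟨⟨?_, rowInsert_sorted x h2, ?_, ?_⟩, ?_⟩
    · cases r with
      | nil => simp [rowInsert]
      | cons y ys => rw [rowInsert]; split_ifs <;> simp
    · intro y hy
      rcases mem_of_mem_rowInsert hy with rfl | hy
      exacts [hx, h3 y hy]
    · intro y hy
      rcases mem_of_mem_rowInsert hy with rfl | hy
      exacts [hxn, h4 y hy]
    · rcases h : (rowInsert x r).2 with _ | y
      · exact hrs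
      · have hy := mem_of_mem_rowInsert_bumped (Option.mem_def.2 h)
        exact ih hrs (h3 y hy) (h4 y hy)

lemma insertWord {n : ℕ} {u : List ℕ} {T : List (List ℕ)} (hT : IsRowTableau n T)
    (hu : ∀ x ∈ u, 1 ≤ x ∧ x ≤ n) : IsRowTableau n (insertWord u T) := by
  induction u generalizing T with
  | nil => exact hT
  | cons x u ih =>
    rw [List.forall_mem_cons] at hu
    exact ih (hT.insert hu.1.1 hu.1.2) hu.2

lemma placeInRow {n j k : ℕ} {T : List (List ℕ)} (hT : IsRowTableau n T) (hj : 1 ≤ j)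
    (hjn : j ≤ n) (hle : ∀ r ∈ T, ∀ x ∈ r, x ≤ j) : IsRowTableau n (placeInRow j k T) := by
  induction T generalizing k with
  | nil => cases k <;> exact singleton hj hjn
  | cons r rs ih =>
    obtain ⟨⟨h1, h2, h3, h4⟩, hrs⟩ := cons_iff.1 hT
    rw [List.forall_mem_cons] at hle
    cases k with
    | zero =>
      refine cons_iff.2 ⟨⟨by simp, ?_, ?_, ?_⟩, hrs⟩
      · rw [List.pairwise_append]
        exact ⟨h2, by simp, fun x hx y hy => by simp at hy; subst hy; exact hle.1 x hx⟩
      · simpa [or_imp, forall_and, hj] using h3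
      · simpa [or_imp, forall_and, hjn] using h4
    | succ k => exact cons_iff.2 ⟨⟨h1, h2, h3, h4⟩, ih hrs hle.2⟩

/-- Tableaux are determined by the numbers of entries at most `m` in their rows. -/
lemma ext {n : ℕ} {S T : List (List ℕ)} (hS : IsRowTableau n S) (hT : IsRowTableau n T)
    (h : ∀ m ≤ n, ∀ k, cnt m (row S k) = cnt m (row T k)) : S = T := by
  have hrow : ∀ k, row S k = row T k := by
    intro k
    refine List.Perm.eq_of_pairwise (le := (· ≤ ·)) (fun a b _ _ => le_antisymm)
      (hS.row_sorted k) (hT.row_sorted k) (List.perm_iff_count.2 fun x => ?_)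
    rcases Nat.eq_zero_or_pos x with rfl | hx
    · rw [List.count_eq_zero.2 fun h => by simpa using hS.row_pos k _ h,
        List.count_eq_zero.2 fun h => by simpa using hT.row_pos k _ h]
    · obtain ⟨x, rfl⟩ : ∃ y, x = y + 1 := ⟨x - 1, by omega⟩
      rcases le_or_gt (x + 1) n with hxn | hxn
      · have h1 := h (x + 1) hxn k
        have h2 := h x (by omega) k
        rw [cnt_succ, cnt_succ] at h1
        omega
      · rw [List.count_eq_zero.2 fun h => by have := hS.row_le k _ h; omega,
          List.count_eq_zero.2 fun h => by have := hT.row_le k _ h; omega]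
  have hlen : ∀ k, k < S.length ↔ k < T.length := fun k => by
    rw [← hS.row_ne_nil, ← hT.row_ne_nil, hrow]
  refine List.ext_getElem (by have := hlen S.length; have := hlen T.length; omega) ?_
  intro k h1 h2
  simpa [row, List.getD_eq_getElem?_getD, h1, h2] using hrow k

end IsRowTableau

/-! ### The growth diagram of a matrix -/

/-- The shapes in the growth diagram of `a`, as sequences of row lengths. -/
def growth (a : ℕ → ℕ → ℕ) : ℕ → ℕ → ℕ → ℕ
  | 0, _ => fun _ => 0
  | _ + 1, 0 => fun _ => 0
  | i + 1, j + 1 => grow (a i j) (growth a i j) (growth a (i + 1) j) (growth a i (j + 1))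
termination_by i j => (i, j)

lemma growth_zero_left (a : ℕ → ℕ → ℕ) (j : ℕ) : growth a 0 j = fun _ => 0 := by
  rw [growth]

lemma growth_zero_right (a : ℕ → ℕ → ℕ) (i : ℕ) : growth a i 0 = fun _ => 0 := by
  cases i <;> rw [growth]

lemma growth_succ_succ (a : ℕ → ℕ → ℕ) (i j : ℕ) : growth a (i + 1) (j + 1) =
    grow (a i j) (growth a i j) (growth a (i + 1) j) (growth a i (j + 1)) := by
  rw [growth]

lemma growth_symm {a : ℕ → ℕ → ℕ} (ha : ∀ i j, a i j = a j i) (i j : ℕ) :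
    growth a i j = growth a j i := by
  induction i generalizing j with
  | zero => rw [growth_zero_left, growth_zero_right]
  | succ i ihi =>
    induction j with
    | zero => rw [growth_zero_left, growth_zero_right]
    | succ j ihj =>
      rw [growth_succ_succ, growth_succ_succ, ihi j, ihi (j + 1), ihj, grow_comm, ha]

/-- The weakly increasing word with `f j` letters `j + 1` for `j < n`. -/
def rowWord (f : ℕ → ℕ) (n : ℕ) : List ℕ :=
  (List.range n).flatMap fun j => List.replicate (f j) (j + 1)

lemma rowWord_succ (f : ℕ → ℕ) (n : ℕ) :
    rowWord f (n + 1) = rowWord f n ++ List.replicate (f n) (n + 1) := by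
  simp [rowWord, List.range_succ]

lemma mem_rowWord {f : ℕ → ℕ} {n x : ℕ} (h : x ∈ rowWord f n) : 1 ≤ x ∧ x ≤ n := by
  simp only [rowWord, List.mem_flatMap, List.mem_range, List.mem_replicate] at h
  obtain ⟨j, hj, -, rfl⟩ := h
  omega

lemma rowWord_sorted (f : ℕ → ℕ) (n : ℕ) : (rowWord f n).Pairwise (· ≤ ·) := by
  induction n with
  | zero => simp [rowWord]
  | succ n ih =>
    rw [rowWord_succ, List.pairwise_append]
    refine ⟨ih, by simp [List.pairwise_replicate], fun x hx y hy => ?_⟩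
    have := mem_rowWord hx
    have := List.eq_of_mem_replicate hy
    omega

lemma count_rowWord (f : ℕ → ℕ) {n m : ℕ} (h : m < n) :
    (rowWord f n).count (m + 1) = f m := by
  induction n with
  | zero => omega
  | succ n ih =>
    rw [rowWord_succ, List.count_append, List.count_replicate]
    rcases Nat.lt_succ_iff_lt_or_eq.1 h with h | rfl
    · have : n ≠ m := by omega
      simp [ih h, this]
    · rw [List.count_eq_zero.2 fun h => by have := mem_rowWord h; omega]
      simp

/-- One step of the growth diagram: inserting the next row of the matrix. -/
lemma cnt_insertWord_rowWord {a : ℕ → ℕ → ℕ} {n i : ℕ} {T : List (List ℕ)}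
    (hT : ∃ N, IsRowTableau N T)
    (h : ∀ m ≤ n, ∀ k, cnt m (row T k) = growth a i m k) {m : ℕ} (hm : m ≤ n) (k : ℕ) :
    cnt m (row (insertWord (rowWord (a i) n) T) k) = growth a (i + 1) m k := by
  obtain ⟨N, hT⟩ := hT
  induction m generalizing k with
  | zero =>
    have : IsRowTableau (max n N) (insertWord (rowWord (a i) n) T) :=
      (hT.mono (le_max_right _ _)).insertWord fun x hx => by
        have := mem_rowWord hx
        omega
    rw [this.cnt_zero, growth_zero_right]
  | succ m ih =>
    rw [cnt_insertWord (rowWord_sorted _ _) hT.sorted, growth_succ_succ, count_rowWord _ (by omega)]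
    congr 1
    · funext k; exact h m (by omega) k
    · funext k; exact ih (by omega) k
    · funext k; exact h (m + 1) hm k

/-! ### The classical algorithm -/

lemma insert_snd_le (x : ℕ) (T : List (List ℕ)) : (insert x T).2 ≤ T.length := by
  induction T generalizing x with
  | nil => simp [insert]
  | cons r rs ih =>
    rw [insert]
    rcases rowInsert x r with ⟨r', _ | y⟩
    · simp
    · simpa using ih y

lemma length_insert (x : ℕ) (T : List (List ℕ)) :
    (insert x T).1.length = max T.length ((insert x T).2 + 1) := by
  induction T generalizing x with
  | nil => simp [insert]
  | cons r rs ih =>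
    rw [insert]
    rcases rowInsert x r with ⟨r', _ | y⟩
    · simp
    · simpa using ih y

lemma length_row_insert (x : ℕ) (T : List (List ℕ)) (k : ℕ) :
    (row (insert x T).1 k).length =
      (row T k).length + if k = (insert x T).2 then 1 else 0 := by
  induction T generalizing x k with
  | nil => cases k <;> simp [insert]
  | cons r rs ih =>
    have hl := (rowInsert_perm x r).length_eq
    rw [insert]
    rcases h : rowInsert x r with ⟨r', _ | y⟩
    · rw [h] at hl
      cases k <;> simp_all
    · rw [h] at hl
      cases k with
      | zero => simp_all
      | succ k => simpa using ih y k

lemma length_placeInRow (j : ℕ) {k : ℕ} {T : List (List ℕ)} (hk : k ≤ T.length) :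
    (placeInRow j k T).length = max T.length (k + 1) := by
  induction T generalizing k with
  | nil => simp at hk; subst hk; simp [placeInRow]
  | cons r rs ih =>
    cases k with
    | zero => simp [placeInRow]
    | succ k => simpa [placeInRow] using ih (by simpa using hk)

lemma row_placeInRow (j : ℕ) {k : ℕ} {T : List (List ℕ)} (hk : k ≤ T.length) (l : ℕ) :
    row (placeInRow j k T) l = row T l ++ List.replicate (if l = k then 1 else 0) j := by
  induction T generalizing k l with
  | nil => simp at hk; subst hk; cases l <;> simp [placeInRow]
  | cons r rs ih =>
    cases k with
    | zero => cases l <;> simp [placeInRow]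
    | succ k =>
      cases l with
      | zero => simp [placeInRow]
      | succ l => simpa [placeInRow] using ih (by simpa using hk) l

/-- While the top entry stays `t`, each new cell of the insertion tableau is matched by a `t` at the
end of the same row of the recording tableau. -/
lemma foldl_rskStep {t : ℕ} (ht : 1 ≤ t) (u : List ℕ) {P Q : List (List ℕ)}
    (hlen : P.length = Q.length) (hQ : IsRowTableau t Q) :
    ∃ Q', (u.map (t, ·)).foldl rskStep (P, Q) = (insertWord u P, Q') ∧
      (insertWord u P).length = Q'.length ∧ IsRowTableau t Q' ∧
      ∀ k, ∃ q, row Q' k = row Q k ++ List.replicate q t ∧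
        (row (insertWord u P) k).length = (row P k).length + q := by
  induction u generalizing P Q with
  | nil => exact ⟨Q, rfl, hlen, hQ, fun k => ⟨0, by simp [insertWord]⟩⟩
  | cons x u ih =>
    have hx := insert_snd_le x P
    have hxQ := hlen ▸ hx
    obtain ⟨Q', h1, h2, h3, h4⟩ := ih (P := (insert x P).1)
      (Q := placeInRow t (insert x P).2 Q)
      (by rw [length_insert, length_placeInRow t hxQ, hlen])
      (hQ.placeInRow ht le_rfl hQ.le)
    refine ⟨Q', h1, h2, h3, fun k => ?_⟩
    obtain ⟨q, hq, hq'⟩ := h4 k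
    refine ⟨(if k = (insert x P).2 then 1 else 0) + q, ?_, ?_⟩
    · rw [hq, row_placeInRow t hxQ, List.append_assoc, List.replicate_add]
    · rw [← add_assoc, ← length_row_insert, ← hq']
      rfl

/-- The two-line array of the first `i` rows of `a`. -/
def rowsArray (a : ℕ → ℕ → ℕ) (n i : ℕ) : List (ℕ × ℕ) :=
  (List.range i).flatMap fun i => (rowWord (a i) n).map (i + 1, ·)

lemma rsk_rowsArray (a : ℕ → ℕ → ℕ) (n i : ℕ) :
    ∃ P Q, rsk (rowsArray a n i) = (P, Q) ∧ IsRowTableau n P ∧ IsRowTableau i Q ∧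
      P.length = Q.length ∧ (∀ k, (row P k).length = (row Q k).length) ∧
      (∀ m ≤ n, ∀ k, cnt m (row P k) = growth a i m k) ∧
      ∀ m ≤ i, ∀ k, cnt m (row Q k) = growth a m n k := by
  induction i with
  | zero =>
    refine ⟨[], [], rfl, .nil n, .nil 0, rfl, fun k => rfl, fun m _ k => ?_, fun m hm k => ?_⟩
    · simp [growth_zero_left, cnt_nil]
    · obtain rfl : m = 0 := by omega
      simp [growth_zero_left, cnt_nil]
  | succ i ih =>
    obtain ⟨P, Q, h, hP, hQ, hlen, hrow, hcP, hcQ⟩ := ih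
    obtain ⟨Q', h1, h2, h3, h4⟩ := foldl_rskStep (Nat.succ_pos i) (rowWord (a i) n) hlen
      (hQ.mono (Nat.le_succ i))
    have hP' : IsRowTableau n (insertWord (rowWord (a i) n) P) :=
      hP.insertWord fun x hx => mem_rowWord hx
    have hcP' := fun m (hm : m ≤ n) k => cnt_insertWord_rowWord ⟨n, hP⟩ hcP hm k
    have hrow' : ∀ k, (row (insertWord (rowWord (a i) n) P) k).length = (row Q' k).length := by
      intro k
      obtain ⟨q, hq, hq'⟩ := h4 k
      rw [hq', hq, hrow, List.length_append, List.length_replicate]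
    refine ⟨_, Q', ?_, hP', h3, h2, hrow', hcP', fun m hm k => ?_⟩
    · rw [rsk, rowsArray, List.range_succ, List.flatMap_append, List.foldl_append,
        ← rowsArray, ← rsk, h, ← h1]
      simp
    · rcases Nat.le_succ_iff.1 hm with hm | rfl
      · obtain ⟨q, hq, -⟩ := h4 k
        rw [hq, cnt_append, cnt_replicate, if_neg (by omega), add_zero, hcQ m hm]
      -- For the newest bound every entry counts, so the count is the row length, shared with the
      -- insertion tableau.
      · rw [h3.cnt_eq_length, ← hrow', ← hP'.cnt_eq_length, hcP' n le_rfl]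

/-- For a symmetric matrix the insertion tableau and the recording tableau coincide. -/
lemma rsk_rowsArray_symm {a : ℕ → ℕ → ℕ} (ha : ∀ i j, a i j = a j i) (n : ℕ) :
    ∃ P, rsk (rowsArray a n n) = (P, P) ∧ IsRowTableau n P ∧
      ∀ m ≤ n, ∀ k, cnt m (row P k) = growth a n m k := by
  obtain ⟨P, Q, h, hP, hQ, -, -, hcP, hcQ⟩ := rsk_rowsArray a n n
  obtain rfl : P = Q := hP.ext hQ fun m hm k => by
    rw [hcP m hm, hcQ m hm, growth_symm ha]
  exact ⟨P, h, hP, hcP⟩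

/-! ### The simplified algorithm -/

/-- What the simplified algorithm does from some row on when it processes a column with top entry
`j`: either a letter is inserted, or, if there is none, then `j` is placed in the first row. -/
def tokenStep (j : ℕ) (T : List (List ℕ)) : Option ℕ → List (List ℕ)
  | some x => simplifiedStep T (j, x)
  | none => placeInRow j 0 T

/-- The step factors through the rows: a bumped letter is again below `j` and continues as a letter,
while an insertion ending here sends `none` down, which puts `j` in the next row. -/
lemma tokenStep_cons_some {j x : ℕ} {r : List ℕ} {rs : List (List ℕ)} (hx : x < j)
    (hr : ∀ y ∈ r, y < j) :
    tokenStep j (r :: rs) (some x) =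
      (rowInsert x r).1 :: tokenStep j rs (rowInsert x r).2 := by
  have hy := fun y => hr y ∘ mem_of_mem_rowInsert_bumped (x := x) (r := r) (y := y)
  simp only [tokenStep, simplifiedStep, hx, if_true]
  rw [insert]
  rcases h : rowInsert x r with ⟨r', _ | y⟩
  · simp [placeInRow]
  · have : y < j := hy y (by simp [h])
    simp [placeInRow, this]

lemma foldl_tokenStep_cons_some {j : ℕ} {u r : List ℕ} {rs : List (List ℕ)}
    (hu : ∀ x ∈ u, x < j) (hr : ∀ y ∈ r, y < j) :
    (u.map some).foldl (tokenStep j) (r :: rs) =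
      (rowOut u r).1 :: (rowOut u r).2.foldl (tokenStep j) rs := by
  induction u generalizing r rs with
  | nil => rfl
  | cons x u ih =>
    rw [List.forall_mem_cons] at hu
    rw [List.map_cons, List.foldl_cons, tokenStep_cons_some hu.1 hr, ih hu.2]
    · rfl
    · intro y hy
      rcases mem_of_mem_rowInsert hy with rfl | hy
      exacts [hu.1, hr y hy]

lemma foldl_tokenStep_cons_none (j q : ℕ) (r : List ℕ) (rs : List (List ℕ)) :
    (List.replicate q none).foldl (tokenStep j) (r :: rs) = (r ++ List.replicate q j) :: rs := by
  induction q generalizing r with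
  | zero => simp
  | succ q ih =>
    rw [List.replicate_succ, List.foldl_cons]
    exact (ih _).trans (by simp [List.replicate_succ])

lemma row_foldl_tokenStep_nil {j : ℕ} {u : List ℕ} (q : ℕ) (hu : ∀ x ∈ u, x < j) (k : ℕ) :
    row ((u.map some ++ List.replicate q none).foldl (tokenStep j) []) k =
      row ((u.map some ++ List.replicate q none).foldl (tokenStep j) [[]]) k := by
  cases u with
  | nil =>
    cases q with
    | zero => cases k <;> simp
    | succ q => rfl
  | cons x u =>
    have hx : x < j := hu x (by simp)
    simp [tokenStep, simplifiedStep, insert, rowInsert, placeInRow, hx]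

/-- Each row receives letters first and `none`s afterwards (`rowOut_snd_eq`), so no letter ever
meets an entry `j` already placed in that row. The letters thus act as in plain insertion, and every
new cell of a row yields one `j` in the next. -/
lemma row_foldl_tokenStep {j : ℕ} {u : List ℕ} {T : List (List ℕ)} (q : ℕ)
    (hu : u.Pairwise (· ≤ ·)) (huj : ∀ x ∈ u, x < j) (hT : ∀ r ∈ T, r.Pairwise (· ≤ ·))
    (hTj : ∀ r ∈ T, ∀ x ∈ r, x < j) (k : ℕ) :
    row ((u.map some ++ List.replicate q none).foldl (tokenStep j) T) k =
      row (insertWord u T) k ++ List.replicate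
        (k.casesOn q fun k => (row (insertWord u T) k).length - (row T k).length) j := by
  have hcons : ∀ r rs, (∀ s ∈ r :: rs, s.Pairwise (· ≤ ·)) → (∀ s ∈ r :: rs, ∀ x ∈ s, x < j) →
      (u.map some ++ List.replicate q none).foldl (tokenStep j) (r :: rs) =
        ((rowOut u r).1 ++ List.replicate q j) ::
          ((bumped u r).map some ++
            List.replicate ((rowOut u r).1.length - r.length) none).foldl (tokenStep j) rs := by
    intro r rs h hj
    rw [List.foldl_append, foldl_tokenStep_cons_some huj (hj r (by simp)),
      foldl_tokenStep_cons_none, ← rowOut_snd_eq hu (h r (by simp))]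
  induction k generalizing u T q with
  | zero =>
    cases T with
    | nil =>
      rw [row_foldl_tokenStep_nil q huj, row_insertWord_nil, hcons [] [] (by simp) (by simp),
        insertWord_cons]
      rfl
    | cons r rs => rw [hcons r rs hT hTj, insertWord_cons]; rfl
  | succ k ih =>
    have key : ∀ r rs, (∀ s ∈ r :: rs, s.Pairwise (· ≤ ·)) →
        (∀ s ∈ r :: rs, ∀ x ∈ s, x < j) →
        row ((u.map some ++ List.replicate q none).foldl (tokenStep j) (r :: rs)) (k + 1) =
          row (insertWord u (r :: rs)) (k + 1) ++ List.replicate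
            ((row (insertWord u (r :: rs)) k).length - (row (r :: rs) k).length) j := by
      intro r rs h hj
      have hr := h r (by simp)
      have hb : ∀ x ∈ bumped u r, x < j := fun x hx =>
        (mem_of_mem_bumped hx).elim (huj x) (hj r (by simp) x)
      rw [hcons r rs h hj, row_cons_succ, insertWord_cons, row_cons_succ,
        ih _ (bumped_sorted hu hr) hb (fun s hs => h s (List.mem_cons_of_mem _ hs))
          (fun s hs => hj s (List.mem_cons_of_mem _ hs))]
      · cases k <;> rfl
      -- `hcons` depends on `u` and `q`, so the induction hypothesis asks for it again for the
      -- bumped word.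
      · intro r' rs' h' hj'
        rw [List.foldl_append, foldl_tokenStep_cons_some hb (hj' r' (by simp)),
          foldl_tokenStep_cons_none,
          ← rowOut_snd_eq (bumped_sorted hu hr) (h' r' (by simp))]
    cases T with
    | nil =>
      have := key [] [] (by simp) (by simp)
      rw [← row_insertWord_nil, ← row_insertWord_nil, ← row_foldl_tokenStep_nil q huj] at this
      rw [this]
      cases k <;> simp
    | cons r rs => exact key r rs hT hTj

lemma IsRowTableau.simplifiedStep {n x : ℕ} {T : List (List ℕ)} (hT : IsRowTableau n T)
    (hx : 1 ≤ x) (hxn : x ≤ n) : IsRowTableau n (simplifiedStep T (n, x)) := by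
  have h := hT.insert hx hxn
  rw [SimplifiedRSK.simplifiedStep]
  split_ifs
  · exact h.placeInRow (hx.trans hxn) le_rfl h.le
  · exact h

lemma rowInsert_of_forall_le {x : ℕ} {r : List ℕ} (h : ∀ y ∈ r, y ≤ x) :
    rowInsert x r = (r ++ [x], none) := by
  induction r with
  | nil => rfl
  | cons y ys ih =>
    rw [List.forall_mem_cons] at h
    simp [rowInsert, ih h.2, Nat.not_lt.2 h.1]

/-- A maximal letter is appended to the first row and triggers no extra placement, so diagonal
columns act as `none`. -/
lemma IsRowTableau.simplifiedStep_self {n : ℕ} {T : List (List ℕ)} (hT : IsRowTableau n T) :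
    SimplifiedRSK.simplifiedStep T (n, n) = tokenStep n T none := by
  cases T with
  | nil => simp [SimplifiedRSK.simplifiedStep, SimplifiedRSK.insert, tokenStep,
      SimplifiedRSK.placeInRow]
  | cons r rs =>
    simp [SimplifiedRSK.simplifiedStep, SimplifiedRSK.insert, tokenStep,
      SimplifiedRSK.placeInRow, rowInsert_of_forall_le (hT.le r (by simp))]

lemma IsRowTableau.foldl_simplifiedStep {n : ℕ} {T : List (List ℕ)} (hT : IsRowTableau n T)
    {u : List ℕ} (hu : ∀ x ∈ u, 1 ≤ x ∧ x ≤ n) :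
    IsRowTableau n ((u.map (n, ·)).foldl SimplifiedRSK.simplifiedStep T) := by
  induction u generalizing T with
  | nil => exact hT
  | cons x u ih =>
    rw [List.forall_mem_cons] at hu
    exact ih (hT.simplifiedStep hu.1.1 hu.1.2) hu.2

lemma IsRowTableau.foldl_simplifiedStep_replicate {n : ℕ} {T : List (List ℕ)}
    (hT : IsRowTableau n T) (hn : 1 ≤ n) (q : ℕ) :
    ((List.replicate q n).map (n, ·)).foldl SimplifiedRSK.simplifiedStep T =
      (List.replicate q none).foldl (tokenStep n) T := by
  induction q generalizing T with
  | zero => rfl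
  | succ q ih =>
    rw [List.replicate_succ, List.map_cons, List.foldl_cons, ih (hT.simplifiedStep hn le_rfl),
      hT.simplifiedStep_self]
    rfl

/-- The two-line array of the upper triangular part of the first `j` columns of `a`. -/
def triangularArray (a : ℕ → ℕ → ℕ) (j : ℕ) : List (ℕ × ℕ) :=
  (List.range j).flatMap fun j => (rowWord (a j) (j + 1)).map (j + 1, ·)

lemma simplifiedRSK_triangularArray {a : ℕ → ℕ → ℕ} (ha : ∀ i j, a i j = a j i) (j : ℕ) :
    IsRowTableau j (simplifiedRSK (triangularArray a j)) ∧
      ∀ m ≤ j, ∀ k,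
        cnt m (row (simplifiedRSK (triangularArray a j)) k) = growth a j m k := by
  induction j with
  | zero =>
    refine ⟨.nil 0, fun m hm k => ?_⟩
    simp [growth_zero_left, triangularArray, simplifiedRSK, cnt_nil]
  | succ j ih =>
    obtain ⟨hT, hc⟩ := ih
    have hstep : simplifiedRSK (triangularArray a (j + 1)) =
        ((rowWord (a j) (j + 1)).map (j + 1, ·)).foldl simplifiedStep
          (simplifiedRSK (triangularArray a j)) := by
      simp [simplifiedRSK, triangularArray, List.range_succ, List.foldl_append]
    rw [hstep]
    generalize simplifiedRSK (triangularArray a j) = T at hT hc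
    have hT' := hT.mono (Nat.le_succ j)
    have hres := hT'.foldl_simplifiedStep fun x hx => mem_rowWord (f := a j) (n := j + 1) hx
    refine ⟨hres, fun m hm k => ?_⟩
    have htok : ((rowWord (a j) (j + 1)).map (j + 1, ·)).foldl simplifiedStep T =
        ((rowWord (a j) j).map some ++ List.replicate (a j j) none).foldl
          (tokenStep (j + 1)) T := by
      rw [rowWord_succ, List.map_append, List.foldl_append, List.foldl_append,
        (hT'.foldl_simplifiedStep fun x hx => _).foldl_simplifiedStep_replicate (Nat.succ_pos j),
        List.foldl_map, List.foldl_map]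
      · rfl
      · intro x hx
        have := mem_rowWord hx
        omega
    have hins : IsRowTableau j (insertWord (rowWord (a j) j) T) :=
      hT.insertWord fun x hx => mem_rowWord hx
    have hcins := fun m (hm : m ≤ j) k => cnt_insertWord_rowWord ⟨j, hT⟩ hc hm k
    have hrow := row_foldl_tokenStep (a j j) (rowWord_sorted (a j) j)
      (fun x hx => Nat.lt_succ_of_le (mem_rowWord hx).2) hT.sorted
      (fun r hr x hx => Nat.lt_succ_of_le (hT.le r hr x hx))
    rcases Nat.le_succ_iff.1 hm with hm | rfl
    · rw [htok, hrow, cnt_append, cnt_replicate, if_neg (by omega), hcins m hm, add_zero]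
    -- The diagonal square: `growth_symm` identifies the two side shapes, and the local rule becomes
    -- old length plus the cells gained in the row above (or plus `a j j` in the first row).
    · rw [hres.cnt_eq_length, htok, hrow, List.length_append, List.length_replicate,
        ← hins.cnt_eq_length, hcins j le_rfl, growth_succ_succ, growth_symm ha j (j + 1)]
      cases k with
      | zero => simp [grow]
      | succ k =>
        simp [grow, ← hins.cnt_eq_length, ← hT.cnt_eq_length, hcins j le_rfl, hc j le_rfl]

/-! ### Inverting the local rule -/

/-- The skew shape between the shapes `μ` and `l` is a horizontal strip. -/
def Interlace (μ l : ℕ → ℕ) : Prop := ∀ k, μ k ≤ l k ∧ l (k + 1) ≤ μ k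

/-- The inverse of the local rule `grow`. -/
def shrink (ρ l l' : ℕ → ℕ) (k : ℕ) : ℕ :=
  min (l k) (l' k) - (ρ (k + 1) - max (l (k + 1)) (l' (k + 1)))

lemma shrink_comm (ρ l l' : ℕ → ℕ) : shrink ρ l l' = shrink ρ l' l := by
  funext k
  simp [shrink, max_comm, min_comm]

lemma Interlace.grow_left {a : ℕ} {μ l l' : ℕ → ℕ} (h : Interlace μ l) (h' : Interlace μ l') :
    Interlace l (grow a μ l l') := by
  intro k
  have := h k
  have := h' k
  refine ⟨?_, by simp only [grow]; omega⟩
  cases k <;> simp only [grow] <;> omega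

lemma Interlace.grow_right {a : ℕ} {μ l l' : ℕ → ℕ} (h : Interlace μ l)
    (h' : Interlace μ l') : Interlace l' (grow a μ l l') :=
  grow_comm a μ l l' ▸ h'.grow_left h

lemma Interlace.shrink_left {ρ l l' : ℕ → ℕ} (h : Interlace l ρ) (h' : Interlace l' ρ) :
    Interlace (shrink ρ l l') l := by
  intro k
  have := h k
  have := h' k
  have := h (k + 1)
  have := h' (k + 1)
  simp only [shrink]
  omega

lemma Interlace.shrink_right {ρ l l' : ℕ → ℕ} (h : Interlace l ρ) (h' : Interlace l' ρ) :
    Interlace (shrink ρ l l') l' :=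
  shrink_comm ρ l l' ▸ h'.shrink_left h

/-- Since `μ k` is at most `l k` and `l' k`, no subtraction truncates, and the growth of row `k + 1`
beyond the maximum is exactly `min (l k) (l' k) - μ k`. -/
lemma shrink_grow {a : ℕ} {μ l l' : ℕ → ℕ} (h : Interlace μ l) (h' : Interlace μ l') :
    shrink (grow a μ l l') l l' = μ := by
  funext k
  have := h k
  have := h' k
  simp only [shrink, grow]
  omega

/-- `shrink` never looks at `ρ 0`; this remaining datum is what the matrix entry encodes. -/
lemma grow_shrink {ρ l l' : ℕ → ℕ} (h : Interlace l ρ) (h' : Interlace l' ρ) :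
    grow (ρ 0 - max (l 0) (l' 0)) (shrink ρ l l') l l' = ρ := by
  funext k
  cases k with
  | zero =>
    have := h 0
    have := h' 0
    simp only [grow]
    omega
  | succ k =>
    have := h k
    have := h' k
    have := h (k + 1)
    have := h' (k + 1)
    simp only [shrink, grow]
    omega

lemma growth_interlace (a : ℕ → ℕ → ℕ) (i j : ℕ) :
    Interlace (growth a i j) (growth a i (j + 1)) ∧
      Interlace (growth a i j) (growth a (i + 1) j) := by
  induction i generalizing j with
  | zero =>
    refine ⟨by simp [growth_zero_left, Interlace], ?_⟩
    induction j with
    | zero => simp [growth_zero_right, Interlace]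
    | succ j ih =>
      rw [growth_succ_succ]
      exact Interlace.grow_right ih (by simp [growth_zero_left, Interlace])
  | succ i ih =>
    have h1 : ∀ j, Interlace (growth a (i + 1) j) (growth a (i + 1) (j + 1)) := fun j => by
      rw [growth_succ_succ]
      exact Interlace.grow_left (ih j).2 (ih j).1
    refine ⟨h1 j, ?_⟩
    induction j with
    | zero => simp [growth_zero_right, Interlace]
    | succ j ihj =>
      rw [growth_succ_succ a (i + 1)]
      exact Interlace.grow_right ihj (h1 j)

/-- A symmetric matrix is determined by the outer shapes of its growth diagram. -/
lemma growth_injective {a b : ℕ → ℕ → ℕ} (ha : ∀ i j, a i j = a j i)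
    (hb : ∀ i j, b i j = b j i) {n : ℕ} (h : ∀ m ≤ n, growth a n m = growth b n m) {i j : ℕ}
    (hi : i < n) (hj : j < n) : a i j = b i j := by
  -- Induction on the distances `p`, `q` from the outer corner: the side `p = 0` is given, the side
  -- `q = 0` follows by symmetry, and `shrink` fills in the rest.
  have key : ∀ p q, p ≤ n → q ≤ n → growth a (n - p) (n - q) = growth b (n - p) (n - q) := by
    intro p
    induction p with
    | zero => intro q _ _; exact h _ (Nat.sub_le _ _)
    | succ p ihp =>
      intro q hp
      induction q with
      | zero =>
        intro _
        rw [growth_symm ha, growth_symm hb]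
        exact h _ (Nat.sub_le _ _)
      | succ q ihq =>
        intro hq
        have h1 := ihp q (by omega) (by omega)
        have h2 := ihp (q + 1) (by omega) (by omega)
        have h3 := ihq (by omega)
        obtain ⟨i, hi⟩ : ∃ i, n - p = i + 1 := ⟨n - p - 1, by omega⟩
        obtain ⟨j, hj⟩ : ∃ j, n - q = j + 1 := ⟨n - q - 1, by omega⟩
        rw [show n - (p + 1) = i by omega, hj] at h3
        rw [show n - (q + 1) = j by omega, hi] at h2
        rw [show n - (p + 1) = i by omega, show n - (q + 1) = j by omega]
        rw [hi, hj, growth_succ_succ, growth_succ_succ] at h1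
        have ga := growth_interlace a i j
        have gb := growth_interlace b i j
        rw [← shrink_grow (a := a i j) ga.2 ga.1, ← shrink_grow (a := b i j) gb.2 gb.1, h1, h2, h3]
  have key' : ∀ i ≤ n, ∀ j ≤ n, growth a i j = growth b i j := fun i hi j hj => by
    have := key (n - i) (n - j) (by omega) (by omega)
    rwa [Nat.sub_sub_self hi, Nat.sub_sub_self hj] at this
  have h1 := congrFun (key' (i + 1) hi (j + 1) hj) 0
  rw [growth_succ_succ, growth_succ_succ] at h1
  simp only [grow] at h1
  rw [key' (i + 1) hi j hj.le, key' i hi.le (j + 1) hj] at h1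
  omega

/-- The growth diagram with given outer shapes, indexed from the outer corner. -/
def decay (X : ℕ → ℕ → ℕ) (n : ℕ) : ℕ → ℕ → ℕ → ℕ
  | 0, q => X (n - q)
  | p + 1, 0 => X (n - (p + 1))
  | p + 1, q + 1 => shrink (decay X n p q) (decay X n p (q + 1)) (decay X n (p + 1) q)
termination_by p q => (p, q)

lemma decay_zero_left (X : ℕ → ℕ → ℕ) (n q : ℕ) : decay X n 0 q = X (n - q) := by rw [decay]

lemma decay_zero_right (X : ℕ → ℕ → ℕ) (n p : ℕ) : decay X n p 0 = X (n - p) := by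
  cases p <;> rw [decay]

lemma decay_succ_succ (X : ℕ → ℕ → ℕ) (n p q : ℕ) : decay X n (p + 1) (q + 1) =
    shrink (decay X n p q) (decay X n p (q + 1)) (decay X n (p + 1) q) := by
  rw [decay]

lemma decay_symm (X : ℕ → ℕ → ℕ) (n p q : ℕ) : decay X n p q = decay X n q p := by
  induction p generalizing q with
  | zero => rw [decay_zero_left, decay_zero_right]
  | succ p ihp =>
    induction q with
    | zero => rw [decay_zero_left, decay_zero_right]
    | succ q ihq => rw [decay_succ_succ, decay_succ_succ, ihp q, ihp (q + 1), ihq, shrink_comm]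

lemma decay_interlace {X : ℕ → ℕ → ℕ} (h0 : X 0 = fun _ => 0)
    (hX : ∀ m, Interlace (X m) (X (m + 1))) (n p q : ℕ) :
    Interlace (decay X n p (q + 1)) (decay X n p q) ∧
      Interlace (decay X n (p + 1) q) (decay X n p q) := by
  have hb : ∀ q, Interlace (X (n - (q + 1))) (X (n - q)) := fun q => by
    rcases lt_or_ge q n with hq | hq
    · rw [show n - q = n - (q + 1) + 1 by omega]
      exact hX _
    -- Beyond the diagram both indices truncate to `0`, and the empty shape interlaces with itself.
    · rw [show n - q = 0 by omega, show n - (q + 1) = 0 by omega, h0]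
      simp [Interlace]
  induction p generalizing q with
  | zero =>
    refine ⟨by simpa only [decay_zero_left] using hb q, ?_⟩
    induction q with
    | zero => simpa only [decay_zero_right] using hb 0
    | succ q ih =>
      rw [decay_succ_succ]
      exact Interlace.shrink_left (by simpa only [decay_zero_left] using hb q) ih
  | succ p ih =>
    have h1 : ∀ q, Interlace (decay X n (p + 1) (q + 1)) (decay X n (p + 1) q) := fun q => by
      rw [decay_succ_succ]
      exact Interlace.shrink_right (ih q).1 (ih q).2
    refine ⟨h1 q, ?_⟩
    induction q with
    | zero => simpa only [decay_zero_right] using hb (p + 1)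
    | succ q ihq =>
      rw [decay_succ_succ X n (p + 1)]
      exact Interlace.shrink_left (h1 q) ihq

/-- The growth diagrams of symmetric matrices have arbitrary outer shapes. -/
lemma growth_surjective {X : ℕ → ℕ → ℕ} (h0 : X 0 = fun _ => 0)
    (hX : ∀ m, Interlace (X m) (X (m + 1))) (n : ℕ) :
    ∃ a : ℕ → ℕ → ℕ, (∀ i j, a i j = a j i) ∧ ∀ m ≤ n, growth a n m = X m := by
  have hI := decay_interlace h0 hX n
  -- The inner border must be empty for this to be a growth diagram: it starts at `X 0`, and
  -- interlacing only lets shapes shrink.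
  have hz : ∀ p, decay X n p n = fun _ => 0 := by
    intro p
    induction p with
    | zero => simp [decay_zero_left, h0]
    | succ p ih =>
      funext k
      have := ((hI p n).2 k).1
      rw [ih] at this
      simpa using this
  let a : ℕ → ℕ → ℕ := fun i j => decay X n (n - (i + 1)) (n - (j + 1)) 0 -
    max (decay X n (n - (i + 1)) (n - j) 0) (decay X n (n - i) (n - (j + 1)) 0)
  refine ⟨a, fun i j => ?_, fun m hm => ?_⟩
  · simp only [a]
    rw [decay_symm X n (n - (i + 1)) (n - (j + 1)), decay_symm X n (n - (i + 1)) (n - j),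
      decay_symm X n (n - i) (n - (j + 1)), max_comm]
  · have key : ∀ i ≤ n, ∀ j ≤ n, growth a i j = decay X n (n - i) (n - j) := by
      intro i
      induction i with
      | zero => intro _ j _; rw [growth_zero_left, decay_symm, Nat.sub_zero, hz]
      | succ i ihi =>
        intro hi j
        induction j with
        | zero => intro _; rw [growth_zero_right, Nat.sub_zero, hz]
        | succ j ihj =>
          intro hj
          rw [growth_succ_succ, ihi (by omega) j (by omega), ihj (by omega),
            ihi (by omega) (j + 1) hj]
          simp only [a]
          obtain ⟨p, hp⟩ : ∃ p, n - (i + 1) = p := ⟨_, rfl⟩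
          obtain ⟨q, hq⟩ : ∃ q, n - (j + 1) = q := ⟨_, rfl⟩
          rw [show n - i = p + 1 by omega, show n - j = q + 1 by omega, hp, hq,
            decay_succ_succ, grow_shrink (hI p q).1 (hI p q).2]
    rw [key n le_rfl m hm, Nat.sub_self, decay_zero_left, Nat.sub_sub_self hm]

/-! ### Semistandard tableaux as lists of rows -/

/-- In a sorted row the entries at most `v` form an initial segment. This translates between entries
and counts. -/
lemma getElem_le_iff_lt_cnt {r : List ℕ} (hr : r.Pairwise (· ≤ ·)) {c : ℕ} (hc : c < r.length)
    (v : ℕ) : r[c] ≤ v ↔ c < cnt v r := by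
  induction r generalizing c with
  | nil => simp at hc
  | cons x r ih =>
    rw [List.pairwise_cons] at hr
    rw [cnt_cons]
    by_cases hx : x ≤ v
    · cases c with
      | zero => simp [hx]
      | succ c => simpa [hx] using ih hr.2 (by simpa using hc)
    · have h0 : cnt v r = 0 := cnt_eq_zero fun y hy => lt_of_lt_of_le (not_le.1 hx) (hr.1 y hy)
      simp only [hx, if_false, h0]
      cases c with
      | zero => simpa using hx
      | succ c =>
        have := hr.1 _ (List.getElem_mem (by simpa using hc : c < r.length))
        simp only [List.getElem_cons_succ]
        omega

lemma cnt_le_length (m : ℕ) (r : List ℕ) : cnt m r ≤ r.length := List.countP_le_length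

/-- The hypothesis on counts is column strictness: below a cell whose entry exceeds `m` there is no
entry at most `m + 1`. Taking `m + 1 = n` also makes the row lengths decrease. -/
lemma exists_rows_eq {n : ℕ} {T : List (List ℕ)} (hT : IsRowTableau n T)
    (h : ∀ m < n, ∀ k, cnt (m + 1) (row T (k + 1)) ≤ cnt m (row T k)) :
    ∃ S : BoundedSSYT n, S.rows = T := by
  have hlen1 : ∀ k, (row T (k + 1)).length ≤ (row T k).length := by
    intro k
    rw [← hT.cnt_eq_length]
    cases n with
    | zero => simp [hT.cnt_zero]
    | succ n => exact (h n (Nat.lt_succ_self n) k).trans (cnt_le_length _ _)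
  have hlen : Antitone fun k => (row T k).length := antitone_nat_of_succ_le hlen1
  have hw : (T.map List.length).SortedGE := by
    rw [List.sortedGE_iff_pairwise, List.pairwise_iff_getElem]
    intro i j hi hj hij
    have := hlen hij.le
    simp only [List.length_map] at hi hj
    simpa [row, List.getD_eq_getElem?_getD, hi, hj] using this
  let μ := YoungDiagram.ofRowLens _ hw
  have hμ : ∀ i j, (i, j) ∈ μ ↔ j < (row T i).length := by
    intro i j
    rw [YoungDiagram.mem_ofRowLens]
    simp only [List.length_map, List.getElem_map]
    constructor
    · rintro ⟨hi, hj⟩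
      simpa [row, List.getD_eq_getElem?_getD, hi] using hj
    · intro hj
      have hi : i < T.length := by
        by_contra hi
        rw [row_eq_nil (not_lt.1 hi)] at hj
        simp at hj
      exact ⟨hi, by simpa [row, List.getD_eq_getElem?_getD, hi] using hj⟩
  have hcol1 : ∀ i j (hj : j < (row T (i + 1)).length),
      (row T i)[j]'(hj.trans_le (hlen1 i)) < (row T (i + 1))[j] := by
    intro i j hj
    have h1 := hT.row_pos _ _ (List.getElem_mem hj)
    have h2 := hT.row_le _ _ (List.getElem_mem hj)
    obtain ⟨v, hv⟩ : ∃ v, (row T (i + 1))[j] = v + 1 := ⟨(row T (i + 1))[j] - 1, by omega⟩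
    have h3 := (getElem_le_iff_lt_cnt (hT.row_sorted _) hj (v + 1)).1 hv.le
    have h4 := (getElem_le_iff_lt_cnt (hT.row_sorted _) (hj.trans_le (hlen1 i)) v).2
      (h3.trans_le (h v (by omega) i))
    omega
  have hcol : ∀ i i' j, i < i' → ∀ hj : j < (row T i').length,
      ∃ hj' : j < (row T i).length, (row T i)[j] < (row T i')[j] := by
    intro i i' j hi hj
    induction i', hi using Nat.le_induction with
    | base => exact ⟨_, hcol1 i j hj⟩
    | succ i' _ ih =>
      obtain ⟨hj', hlt⟩ := ih (hj.trans_le (hlen1 i'))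
      exact ⟨hj', hlt.trans (hcol1 i' j hj)⟩
  let S : SemistandardYoungTableau μ :=
    { entry := fun i j => (row T i).getD j 0
      row_weak' := by
        intro i j1 j2 hj hcell
        rw [hμ] at hcell
        simp only [List.getD_eq_getElem _ _ hcell, List.getD_eq_getElem _ _ (hj.trans hcell)]
        exact List.pairwise_iff_getElem.1 (hT.row_sorted i) _ _ _ _ hj
      col_strict' := by
        intro i1 i2 j hi hcell
        rw [hμ] at hcell
        obtain ⟨hj', hlt⟩ := hcol i1 i2 j hi hcell
        simpa only [List.getD_eq_getElem _ _ hcell, List.getD_eq_getElem _ _ hj'] using hlt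
      zeros' := by
        intro i j hcell
        rw [hμ, not_lt] at hcell
        exact List.getD_eq_default _ _ hcell }
  have hS : ∀ i j, S i j = (row T i).getD j 0 := fun i j => rfl
  refine ⟨⟨⟨μ, S⟩, fun i j hij => ?_⟩, ?_⟩
  · have hj := (hμ i j).1 hij
    change 1 ≤ S i j ∧ S i j ≤ n
    rw [hS, List.getD_eq_getElem _ _ hj]
    exact ⟨hT.row_pos i _ (List.getElem_mem hj), hT.row_le i _ (List.getElem_mem hj)⟩
  · have hrl : ∀ i, μ.rowLen i = (row T i).length := fun i =>
      eq_of_forall_lt_iff fun j => by rw [← YoungDiagram.mem_iff_lt_rowLen, hμ]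
    have hcl : μ.colLen 0 = T.length :=
      eq_of_forall_lt_iff fun k => by
        rw [← YoungDiagram.mem_iff_lt_colLen, hμ, ← hT.row_ne_nil, List.length_pos_iff]
    change (List.range (μ.colLen 0)).map
      (fun i => (List.range (μ.rowLen i)).map fun j => S i j) = T
    refine List.ext_getElem (by simp [hcl]) fun i h1 h2 => ?_
    have hr : row T i = T[i] := List.getD_eq_getElem _ _ h2
    refine List.ext_getElem (by simp [hrl, hr]) fun j h3 h4 => ?_
    simp [hS, hr, h4]

namespace BoundedSSYT

variable {n : ℕ}

lemma row_rows (S : BoundedSSYT n) (k : ℕ) :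
    row S.rows k = (List.range (S.1.1.rowLen k)).map fun j => S.1.2 k j := by
  rcases lt_or_ge k (S.1.1.colLen 0) with hk | hk
  · simp [row, rows, hk]
  · have : S.1.1.rowLen k = 0 := by
      by_contra h
      have := YoungDiagram.mem_iff_lt_rowLen.2 (Nat.pos_of_ne_zero h)
      rw [YoungDiagram.mem_iff_lt_colLen] at this
      omega
    rw [row_eq_nil (by simpa [rows] using hk), this]
    rfl

lemma rows_injective : Function.Injective (rows (n := n)) := by
  intro S S' h
  have hrow := fun k => congrArg (fun T => row T k) h
  simp only [row_rows] at hrow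
  have hlen : ∀ k, S.1.1.rowLen k = S'.1.1.rowLen k := fun k => by
    simpa using congrArg List.length (hrow k)
  obtain ⟨⟨μ, S⟩, hS⟩ := S
  obtain ⟨⟨μ', S'⟩, hS'⟩ := S'
  obtain rfl : μ = μ' := by
    ext ⟨i, j⟩
    simp only [YoungDiagram.mem_cells, YoungDiagram.mem_iff_lt_rowLen]
    exact iff_of_eq (congrArg _ (hlen i))
  congr 2
  ext i j
  by_cases hij : (i, j) ∈ μ
  · have := hrow i
    rw [List.map_inj_left] at this
    exact this j (List.mem_range.2 (YoungDiagram.mem_iff_lt_rowLen.1 hij))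
  · rw [S.zeros hij, S'.zeros hij]

lemma isRowTableau_rows (S : BoundedSSYT n) : IsRowTableau n S.rows := by
  have hmem : ∀ r ∈ S.rows, ∀ x ∈ r, 1 ≤ x ∧ x ≤ n := by
    intro r hr x hx
    simp only [rows, List.mem_map] at hr
    obtain ⟨i, -, rfl⟩ := hr
    simp only [List.mem_map, List.mem_range] at hx
    obtain ⟨j, hj, rfl⟩ := hx
    exact S.2 i j (YoungDiagram.mem_iff_lt_rowLen.2 hj)
  refine ⟨?_, ?_, fun r hr x hx => (hmem r hr x hx).1, fun r hr x hx => (hmem r hr x hx).2⟩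
  · intro r hr
    simp only [rows, List.mem_map, List.mem_range] at hr
    obtain ⟨i, hi, rfl⟩ := hr
    have := YoungDiagram.mem_iff_lt_rowLen.1 (YoungDiagram.mem_iff_lt_colLen.2 hi)
    simp
    omega
  · intro r hr
    simp only [rows, List.mem_map, List.mem_range] at hr
    obtain ⟨i, hi, rfl⟩ := hr
    rw [List.pairwise_iff_getElem]
    intro j j' hj hj' hjj
    simp only [List.length_map, List.length_range] at hj'
    simpa using S.1.2.row_weak hjj (YoungDiagram.mem_iff_lt_rowLen.2 hj')

lemma interlace_rows (S : BoundedSSYT n) (m : ℕ) :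
    Interlace (fun k => cnt m (row S.rows k)) fun k => cnt (m + 1) (row S.rows k) := by
  have hS := S.isRowTableau_rows
  intro k
  refine ⟨cnt_mono (Nat.le_succ m) _, ?_⟩
  -- In column `c = cnt m (row S.rows k)` row `k` has an entry above `m`, while `hlt` puts an entry
  -- at most `m + 1` right below it, against column strictness.
  by_contra! hlt
  have h1 : cnt m (row S.rows k) < (row S.rows (k + 1)).length :=
    hlt.trans_le (cnt_le_length _ _)
  have h2 : cnt m (row S.rows k) < S.1.1.rowLen (k + 1) := by simpa [row_rows S (k + 1)] using h1
  have h3 : cnt m (row S.rows k) < (row S.rows k).length := by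
    have := S.1.1.rowLen_anti k (k + 1) (Nat.le_succ k)
    rw [row_rows S k] at h2 ⊢
    simp only [List.length_map, List.length_range]
    omega
  have h4 := (getElem_le_iff_lt_cnt (hS.row_sorted (k + 1)) h1 (m + 1)).2 hlt
  have h5 := (getElem_le_iff_lt_cnt (hS.row_sorted k) h3 m).not.2 (lt_irrefl _)
  have h6 := S.1.2.col_strict (Nat.lt_add_one k) (YoungDiagram.mem_iff_lt_rowLen.2 h2)
  generalize cnt m (row S.rows k) = c at *
  simp only [row_rows, List.getElem_map, List.getElem_range] at h4 h5
  omega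

end BoundedSSYT

/-! ### The two-line arrays of a matrix -/

/-- The extension by zero of a finite square matrix. -/
def extend {n : ℕ} (A : Matrix (Fin n) (Fin n) ℕ) (i j : ℕ) : ℕ :=
  if h : i < n ∧ j < n then A ⟨i, h.1⟩ ⟨j, h.2⟩ else 0

lemma extend_coe {n : ℕ} (A : Matrix (Fin n) (Fin n) ℕ) (i j : Fin n) :
    extend A i j = A i j := by simp [extend]

lemma extend_symm {n : ℕ} {A : Matrix (Fin n) (Fin n) ℕ} (hA : A.IsSymm) (i j : ℕ) :
    extend A i j = extend A j i := by
  by_cases h : i < n ∧ j < n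
  · simpa [extend, h] using hA.apply ⟨j, h.2⟩ ⟨i, h.1⟩
  · have h' : ¬ (j < n ∧ i < n) := fun h' => h h'.symm
    simp [extend, h, h']

lemma flatMap_finRange {α : Type*} (n : ℕ) (g : ℕ → List α) :
    (List.finRange n).flatMap (fun i : Fin n => g i) = (List.range n).flatMap g := by
  rw [← List.map_coe_finRange_eq_range, List.flatMap_map]

lemma flatMap_filter_finRange {α : Type*} {n : ℕ} (j : Fin n) (g : ℕ → List α) :
    ((List.finRange n).filter fun i : Fin n => i ≤ j).flatMap (fun i : Fin n => g i) =
      (List.range (j + 1)).flatMap g := by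
  have h1 : ∀ n j, j < n → (List.range n).filter (fun i => decide (i ≤ j)) =
      List.range (j + 1) := by
    intro n j h
    induction n with
    | zero => omega
    | succ n ih =>
      rw [List.range_succ, List.filter_append]
      rcases Nat.lt_succ_iff_lt_or_eq.1 h with h | rfl
      · have : ¬ n ≤ j := by omega
        simp [ih h, this]
      · rw [List.range_succ, List.filter_eq_self.2]
        · simp
        · intro i hi
          simp at hi ⊢
          omega
  rw [← h1 n j j.2, ← List.map_coe_finRange_eq_range, List.filter_map, List.flatMap_map]
  rfl

lemma classicalArray_eq {n : ℕ} (A : Matrix (Fin n) (Fin n) ℕ) :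
    classicalArray A = rowsArray (extend A) n n := by
  rw [classicalArray, rowsArray, ← flatMap_finRange]
  congr 1
  funext i
  rw [rowWord, ← flatMap_finRange, List.map_flatMap]
  simp [extend_coe]

/-- Symmetry enters because `triangularArray` reads the entry `(j, i)` in place of `(i, j)`. -/
lemma simplifiedArray_eq {n : ℕ} {A : Matrix (Fin n) (Fin n) ℕ} (hA : A.IsSymm) :
    simplifiedArray A = triangularArray (extend A) n := by
  rw [simplifiedArray, triangularArray, ← flatMap_finRange]
  congr 1
  funext j
  rw [rowWord, ← flatMap_filter_finRange, List.map_flatMap]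
  simp [extend_coe, hA.apply]

/-- The lexicographic order of the columns of two-line arrays. -/
def ColumnLE (c d : ℕ × ℕ) : Prop := c.1 < d.1 ∨ (c.1 = d.1 ∧ c.2 ≤ d.2)

lemma isSimplifiedArray_triangularArray (a : ℕ → ℕ → ℕ) (n : ℕ) :
    IsSimplifiedArray n (triangularArray a n) := by
  induction n with
  | zero => simp [triangularArray, IsSimplifiedArray]
  | succ n ih =>
    obtain ⟨h1, h2⟩ := ih
    have hmem : ∀ c ∈ (rowWord (a n) (n + 1)).map (n + 1, ·),
        c.1 = n + 1 ∧ 1 ≤ c.2 ∧ c.2 ≤ n + 1 := by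
      intro c hc
      obtain ⟨x, hx, rfl⟩ := List.mem_map.1 hc
      exact ⟨rfl, mem_rowWord hx⟩
    rw [IsSimplifiedArray, triangularArray, List.range_succ, List.flatMap_append,
      ← triangularArray, List.flatMap_singleton, List.pairwise_append]
    refine ⟨⟨h1, ?_, ?_⟩, ?_⟩
    · rw [List.pairwise_map]
      exact (rowWord_sorted _ _).imp fun h => Or.inr ⟨rfl, h⟩
    · intro c hc d hd
      have := h2 c hc
      have := hmem d hd
      omega
    · intro c hc
      rcases List.mem_append.1 hc with hc | hc
      · have := h2 c hc
        omega
      · have := hmem c hc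
        omega

lemma count_triangularArray (a : ℕ → ℕ → ℕ) {n i j : ℕ} (hij : i ≤ j) (hj : j < n) :
    (triangularArray a n).count (j + 1, i + 1) = a j i := by
  induction n with
  | zero => omega
  | succ n ih =>
    rw [triangularArray, List.range_succ, List.flatMap_append, ← triangularArray,
      List.flatMap_singleton, List.count_append]
    rcases Nat.lt_succ_iff_lt_or_eq.1 hj with hj | rfl
    · rw [ih hj, List.count_eq_zero.2, add_zero]
      intro h
      obtain ⟨x, -, hx⟩ := List.mem_map.1 h
      simp at hx
      omega
    · rw [List.count_eq_zero.2, zero_add, List.count_map_of_injective _ _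
        (Prod.mk_right_injective _), count_rowWord _ (by omega)]
      intro h
      have := (isSimplifiedArray_triangularArray a j).2 _ h
      omega

/-- A list sorted by an antisymmetric relation is determined by its multiplicities, and inadmissible
columns occur in neither array. -/
lemma IsSimplifiedArray.eq_of_count {n : ℕ} {w w' : List (ℕ × ℕ)} (hw : IsSimplifiedArray n w)
    (hw' : IsSimplifiedArray n w')
    (h : ∀ i j, i ≤ j → j < n → w.count (j + 1, i + 1) = w'.count (j + 1, i + 1)) : w = w' := by
  refine List.Perm.eq_of_pairwise (le := ColumnLE) ?_ hw.1 hw'.1 (List.perm_iff_count.2 ?_)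
  · rintro ⟨c, c'⟩ ⟨d, d'⟩ _ _ h1 h2
    simp only [ColumnLE] at h1 h2
    ext <;> simp only <;> omega
  · rintro ⟨c, c'⟩
    by_cases hc : 1 ≤ c' ∧ c' ≤ c ∧ c ≤ n
    · have := h (c' - 1) (c - 1) (by omega) (by omega)
      rwa [Nat.sub_add_cancel (by omega), Nat.sub_add_cancel hc.1] at this
    · rw [List.count_eq_zero.2 fun hm => hc (hw.2 _ hm),
        List.count_eq_zero.2 fun hm => hc (hw'.2 _ hm)]

lemma bijOn_simplifiedArray (n : ℕ) :
    Set.BijOn (fun A : Matrix (Fin n) (Fin n) ℕ => simplifiedArray A)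
      {A | A.IsSymm} {w | IsSimplifiedArray n w} := by
  refine ⟨fun A (hA : A.IsSymm) => ?_, fun A (hA : A.IsSymm) B (hB : B.IsSymm) h => ?_,
    fun w (hw : IsSimplifiedArray n w) => ?_⟩
  · change IsSimplifiedArray n (simplifiedArray A)
    rw [simplifiedArray_eq hA]
    exact isSimplifiedArray_triangularArray _ _
  · simp only [simplifiedArray_eq hA, simplifiedArray_eq hB] at h
    have key : ∀ i j : Fin n, i ≤ j → A j i = B j i := fun i j hij => by
      rw [← extend_coe A, ← extend_coe B, ← count_triangularArray (extend A) hij j.2, h,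
        count_triangularArray (extend B) hij j.2]
    ext i j
    rcases le_total i j with hij | hij
    · rw [← hA.apply, ← hB.apply, key i j hij]
    · exact key j i hij
  · let A : Matrix (Fin n) (Fin n) ℕ :=
      fun i j => w.count ((max i j : ℕ) + 1, (min i j : ℕ) + 1)
    have hA : A.IsSymm := by
      ext i j
      rw [Matrix.transpose_apply]
      simp only [A]
      rw [max_comm, min_comm]
    refine ⟨A, hA, ?_⟩
    simp only [simplifiedArray_eq hA]
    refine (isSimplifiedArray_triangularArray _ _).eq_of_count hw fun i j hij hj => ?_
    have hi : i < n := by omega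
    rw [count_triangularArray _ hij hj]
    simp [extend, A, hi, hj, hij]

/-! ### The bijection -/

lemma exists_rows_eq_simplifiedRSK {n : ℕ} {A : Matrix (Fin n) (Fin n) ℕ} (hA : A.IsSymm) :
    ∃ S : BoundedSSYT n, S.rows = simplifiedRSK (simplifiedArray A) := by
  rw [simplifiedArray_eq hA]
  obtain ⟨hT, hc⟩ := simplifiedRSK_triangularArray (extend_symm hA) n
  refine exists_rows_eq hT fun m hm k => ?_
  rw [hc m hm.le, hc (m + 1) hm]
  exact ((growth_interlace _ n m).1 k).2

lemma rsk_classicalArray {n : ℕ} {A : Matrix (Fin n) (Fin n) ℕ} (hA : A.IsSymm) :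
    rsk (classicalArray A) =
      (simplifiedRSK (simplifiedArray A), simplifiedRSK (simplifiedArray A)) := by
  rw [simplifiedArray_eq hA, classicalArray_eq]
  obtain ⟨hT, hc⟩ := simplifiedRSK_triangularArray (extend_symm hA) n
  obtain ⟨P, h, hP, hcP⟩ := rsk_rowsArray_symm (extend_symm hA) n
  rw [h, hP.ext hT fun m hm k => by rw [hc m hm, hcP m hm]]

lemma simplifiedRSK_injective {n : ℕ} {A B : Matrix (Fin n) (Fin n) ℕ} (hA : A.IsSymm)
    (hB : B.IsSymm)
    (h : simplifiedRSK (simplifiedArray A) = simplifiedRSK (simplifiedArray B)) : A = B := by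
  rw [simplifiedArray_eq hA, simplifiedArray_eq hB] at h
  obtain ⟨-, hcA⟩ := simplifiedRSK_triangularArray (extend_symm hA) n
  obtain ⟨-, hcB⟩ := simplifiedRSK_triangularArray (extend_symm hB) n
  ext i j
  rw [← extend_coe A, ← extend_coe B]
  refine growth_injective (extend_symm hA) (extend_symm hB) (fun m hm => ?_) i.2 j.2
  funext k
  rw [← hcA m hm, ← hcB m hm, h]

/-- Needed because the array produced by `growth_surjective` need not vanish outside the `n × n`
square, unlike the extension of its restriction. -/
lemma triangularArray_congr {a b : ℕ → ℕ → ℕ} {n : ℕ}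
    (h : ∀ i < n, ∀ j < n, a i j = b i j) : triangularArray a n = triangularArray b n := by
  refine (isSimplifiedArray_triangularArray a n).eq_of_count
    (isSimplifiedArray_triangularArray b n) fun i j hij hj => ?_
  rw [count_triangularArray a hij hj, count_triangularArray b hij hj, h j hj i (by omega)]

lemma simplifiedRSK_surjective {n : ℕ} (S : BoundedSSYT n) :
    ∃ A : Matrix (Fin n) (Fin n) ℕ, A.IsSymm ∧
      simplifiedRSK (simplifiedArray A) = S.rows := by
  have hS := S.isRowTableau_rows
  obtain ⟨a, ha, hag⟩ := growth_surjective (X := fun m k => cnt m (row S.rows k))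
    (funext hS.cnt_zero) S.interlace_rows n
  let A : Matrix (Fin n) (Fin n) ℕ := fun i j => a i j
  have hA : A.IsSymm := by
    ext i j
    exact ha j i
  refine ⟨A, hA, ?_⟩
  obtain ⟨hT, hc⟩ := simplifiedRSK_triangularArray ha n
  rw [simplifiedArray_eq hA, triangularArray_congr (b := a)]
  · exact hT.ext hS fun m hm k => by rw [hc m hm, hag m hm]
  · intro i hi j hj
    simp [extend, A, hi, hj]

end SimplifiedRSK

theorem mainTheorem9 (n : ℕ) :
    -- symmetric matrices correspond to the two-line arrays the simplified algorithm works on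
    Set.BijOn (fun A : Matrix (Fin n) (Fin n) ℕ => SimplifiedRSK.simplifiedArray A)
      {A | A.IsSymm} {w | SimplifiedRSK.IsSimplifiedArray n w} ∧
    -- the simplified algorithm always produces a semistandard Young tableau
    (∀ w : List (ℕ × ℕ), SimplifiedRSK.IsSimplifiedArray n w →
      ∃ T : SimplifiedRSK.BoundedSSYT n, T.rows = SimplifiedRSK.simplifiedRSK w) ∧
    -- it establishes a bijection, which is the same as the classical one
    ∃ Φ : {A : Matrix (Fin n) (Fin n) ℕ // A.IsSymm} ≃ SimplifiedRSK.BoundedSSYT n,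
      ∀ A : {A : Matrix (Fin n) (Fin n) ℕ // A.IsSymm},
        (Φ A).rows = SimplifiedRSK.simplifiedRSK (SimplifiedRSK.simplifiedArray A.1) ∧
        SimplifiedRSK.rsk (SimplifiedRSK.classicalArray A.1) = ((Φ A).rows, (Φ A).rows) := by
  refine ⟨SimplifiedRSK.bijOn_simplifiedArray n, fun w hw => ?_, ?_⟩
  -- Every admissible array comes from a symmetric matrix, so the growth diagram is available.
  · obtain ⟨A, hA, rfl⟩ := (SimplifiedRSK.bijOn_simplifiedArray n).surjOn hw
    exact SimplifiedRSK.exists_rows_eq_simplifiedRSK hA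
  · choose f hf using fun A : {A : Matrix (Fin n) (Fin n) ℕ // A.IsSymm} =>
      SimplifiedRSK.exists_rows_eq_simplifiedRSK A.2
    refine ⟨Equiv.ofBijective f ⟨fun A B h => ?_, fun S => ?_⟩, fun A => ⟨hf A, ?_⟩⟩
    · refine Subtype.ext (SimplifiedRSK.simplifiedRSK_injective A.2 B.2 ?_)
      rw [← hf, ← hf, h]
    · obtain ⟨A, hA, h⟩ := SimplifiedRSK.simplifiedRSK_surjective S
      exact ⟨⟨A, hA⟩, SimplifiedRSK.BoundedSSYT.rows_injective ((hf _).trans h)⟩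
    · change _ = ((f A).rows, (f A).rows)
      rw [hf, SimplifiedRSK.rsk_classicalArray A.2]
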